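/- A presentation (string rewriting system) $\Sigma=(\Sigma_1,\Sigma_2)$ consists of a set $\Sigma_1$ of generators and a set $\Sigma_2$ of rules, each rule $\alpha$ having a source $s(\alpha)$ and a target $t(\alpha)$ in the free monoid $\Sigma_1^*$. It is finite if $\Sigma_1$ and $\Sigma_2$ are finite. A rewriting step is $w\,s(\alpha)\,w' \Rightarrow w\,t(\alpha)\,w'$ with $\alpha\in\Sigma_2$ and $w,w'\in\Sigma_1^*$, and a word $u$ rewrites into $v$ if there is a finite (possibly empty) sequence of rewriting steps from $u$ to $v$. The presentation $\Sigma$ is convergent if there is no infinite sequence of rewriting steps and if, whenever $u$ rewrites into both $v$ and $w$, there is a word into which both $v$ and $w$ rewrite. It is a presentation of a monoid $\mathbf{M}$ if $\mathbf{M}$ is isomorphic to the quotient of $\Sigma_1^*$ by the congruence generated by the pairs $(s(\alpha),t(\alpha))$, $\alpha\in\Sigma_2$. **Theorem (Squier).** If a monoid $\mathbf{M}$ admits a finite convergent presentation, then $\mathbf{M}$ is of homological type left-$\mathrm{FP}_3$, that is, there exists an exact sequence $$P_3 \longrightarrow P_2 \longrightarrow P_1 \longrightarrow P_0 \longrightarrow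 \mathbb{Z} \longrightarrow 0$$ of left $\mathbb{Z}\mathbf{M}$-modules in which $P_0,P_1,P_2,P_3$ are finitely generated and projective and $\mathbb{Z}$ is the trivial $\mathbb{Z}\mathbf{M}$-module (every element of $\mathbf{M}$ acts as the identity). -/

import Mathlib

universe u v w x

/-- A string rewriting system (a 2-polygraph with exactly one 0-cell): generators, together with
a family of directed rules `src r ⇒ tgt r` between words on the generators. -/
structure StringRewritingSystem where
  /-- the generators (1-cells) -/
  Gen : Type v
  /-- the rules (2-cells) -/
  Rule : Type w
  /-- the source of a rule -/
  src : Rule → FreeMonoid Gen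
  /-- the target of a rule -/
  tgt : Rule → FreeMonoid Gen

namespace StringRewritingSystem

variable (S : StringRewritingSystem.{v, w})

/-- `S` is finite: finitely many generators and finitely many rules. -/
def IsFinite : Prop := Finite S.Gen ∧ Finite S.Rule

/-- The relation on words given by the rules themselves. -/
def Rel (a b : FreeMonoid S.Gen) : Prop := ∃ r : S.Rule, S.src r = a ∧ S.tgt r = b

/-- `a` rewrites to `b` in one rewriting step: a rule is applied once, inside a context. -/
def Step (a b : FreeMonoid S.Gen) : Prop :=
  ∃ (l : FreeMonoid S.Gen) (r : S.Rule) (l' : FreeMonoid S.Gen),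
    a = l * S.src r * l' ∧ b = l * S.tgt r * l'

/-- `a` rewrites to `b` by a finite, possibly empty, sequence of rewriting steps. -/
def Rewrites : FreeMonoid S.Gen → FreeMonoid S.Gen → Prop := Relation.ReflTransGen S.Step

/-- There is no infinite rewriting sequence. -/
def Terminates : Prop :=
  ¬ ∃ f : ℕ → FreeMonoid S.Gen, ∀ n, S.Step (f n) (f (n + 1))

/-- Any two rewriting sequences with a common source can be completed to a common target. -/
def Confluent : Prop :=
  ∀ a b c : FreeMonoid S.Gen, S.Rewrites a b → S.Rewrites a c →
    ∃ e : FreeMonoid S.Gen, S.Rewrites b e ∧ S.Rewrites c e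

/-- `S` is convergent: it terminates and it is confluent. -/
def Convergent : Prop := S.Terminates ∧ S.Confluent

/-- `S` presents `M`: the quotient of the free monoid on the generators by the congruence
generated by the rules is isomorphic to `M`. -/
def Presents (M : Type u) [Monoid M] : Prop := Nonempty (PresentedMonoid S.Rel ≃* M)

end StringRewritingSystem

/-- The monoid `M` admits a finite convergent presentation. -/
def AdmitsFiniteConvergentPresentation (M : Type u) [Monoid M] : Prop :=
  ∃ S : StringRewritingSystem.{v, w}, S.IsFinite ∧ S.Convergent ∧ S.Presents M

/-- A partial resolution of length `n` of the left `R`-module `N`, that is, an exact sequence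
`P n → P (n - 1) → ⋯ → P 1 → P 0 → N → 0`. Nothing is required at `P n`, and the terms
of index greater than `n` are not part of the resolution: no condition bears on them. -/
structure PartialResolution (R : Type u) [Ring R] (N : Type v) [AddCommGroup N] [Module R N]
    (n : ℕ) where
  /-- the modules of the resolution -/
  P : ℕ → Type x
  [addCommGroup : ∀ k, AddCommGroup (P k)]
  [module : ∀ k, Module R (P k)]
  /-- the boundary map to `N` -/
  ε : P 0 →ₗ[R] N
  /-- the boundary maps between consecutive modules -/
  d : ∀ k, P (k + 1) →ₗ[R] P k
  surjective_ε : Function.Surjective ε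
  exact_zero : 1 ≤ n → Function.Exact (d 0) ε
  exact_succ : ∀ k, k + 2 ≤ n → Function.Exact (d (k + 1)) (d k)

attribute [instance] PartialResolution.addCommGroup PartialResolution.module

/-- The monoid ring `ℤM`. -/
abbrev IntegralMonoidRing (M : Type u) [Monoid M] : Type u := MonoidAlgebra ℤ M

/-- The trivial left `ℤM`-module: the abelian group `ℤ`, on which every `m : M` acts as the
identity. -/
abbrev TrivialModule (M : Type u) [Monoid M] : Type := (Representation.trivial ℤ M ℤ).asModule

/-- `M` is of homological type left-FPₙ: the trivial left `ℤM`-module `ℤ` has a partial resolution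
of length `n` by finitely generated projective left `ℤM`-modules. -/
def IsOfHomologicalTypeLeftFP (n : ℕ) (M : Type u) [Monoid M] : Prop :=
  ∃ F : PartialResolution.{u, 0, u} (IntegralMonoidRing M) (TrivialModule M) n,
    ∀ k, k ≤ n → Module.Finite (IntegralMonoidRing M) (F.P k) ∧
      Module.Projective (IntegralMonoidRing M) (F.P k)

/-! Let `p` be the projection of words onto `M`. The complex `ℤM[Rule] → ℤM[Gen] → ℤM → ℤ`, with
boundaries given by Fox calculus, is exact for any presentation; the point is that convergence and
finiteness make the kernel of `bdRule` finitely generated. A rewriting path has a class in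
`ℤM[Rule]`: each step contributes its rule, translated by the value of its left context, and right
contexts are forgotten. The boundary of the class is the difference of the Fox derivatives of the
endpoints, so two parallel paths differ by a cycle. Newman's Noetherian induction (`sub_pathTo_mem`)
shows that parallel paths to a normal form agree modulo the cycles coming from local branchings.
Disjoint branchings contribute zero, and overlapping ones come, up to context, from words no longer
than two rule sources together. Taking all branchings of bounded length avoids classifying critical
pairs and still leaves a finite set. Normalizing `m̂ x` defines an additive homotopy, and
`ker_bdRule` deduces from it that these cycles generate the whole kernel. -/

namespace StringRewritingSystem

variable (S : StringRewritingSystem.{v, w}) {M : Type u} [Monoid M]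
  (p : FreeMonoid S.Gen →* M)

theorem freeMonoid_mul_eq_mul_iff {α : Type*} {a b c d : FreeMonoid α} :
    a * b = c * d ↔ (∃ e, c = a * e ∧ b = e * d) ∨ ∃ e, a = c * e ∧ d = e * b :=
  List.append_eq_append_iff

/-- The additive map on `X →₀ ℤM` with prescribed values on the `ℤ`-basis `m • x`. -/
noncomputable def extendAdd {X : Type*} {B : Type*} [AddCommGroup B] (g : X → M → B) :
    (X →₀ MonoidAlgebra ℤ M) →+ B :=
  Finsupp.liftAddHom fun x =>
    (Finsupp.liftAddHom fun m => zmultiplesHom B (g x m)).comp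
      (MonoidAlgebra.coeffAddEquiv (R := ℤ) (M := M)).toAddMonoidHom

theorem extendAdd_single {X : Type*} {B : Type*} [AddCommGroup B] (g : X → M → B) (x : X) (m : M) :
    extendAdd g (Finsupp.single x (MonoidAlgebra.of ℤ M m)) = g x m := by
  simp [extendAdd]

theorem addHom_ext_of {X : Type*} {B : Type*} [AddCommGroup B]
    {f g : (X →₀ MonoidAlgebra ℤ M) →+ B}
    (h : ∀ x m, f (Finsupp.single x (MonoidAlgebra.of ℤ M m)) =
      g (Finsupp.single x (MonoidAlgebra.of ℤ M m))) : f = g := by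
  refine Finsupp.addHom_ext' fun x => MonoidAlgebra.addHom_ext' fun m => ?_
  ext
  simpa using h x m

/-! ### Fox calculus and the boundary maps -/

/-- The Fox derivative of a word, in the free left `ℤM`-module on the generators. -/
noncomputable def fox (u : FreeMonoid S.Gen) : S.Gen →₀ MonoidAlgebra ℤ M :=
  FreeMonoid.recOn u 0 fun x _ d =>
    Finsupp.single x 1 + MonoidAlgebra.of ℤ M (p (FreeMonoid.of x)) • d

@[simp] theorem fox_one : S.fox p 1 = 0 := rfl

theorem fox_of_mul (x : S.Gen) (w : FreeMonoid S.Gen) : S.fox p (FreeMonoid.of x * w) =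
    Finsupp.single x 1 + MonoidAlgebra.of ℤ M (p (FreeMonoid.of x)) • S.fox p w := rfl

@[simp] theorem fox_of (x : S.Gen) : S.fox p (FreeMonoid.of x) = Finsupp.single x 1 := by
  simpa using S.fox_of_mul p x 1

theorem fox_mul (a b : FreeMonoid S.Gen) :
    S.fox p (a * b) = S.fox p a + MonoidAlgebra.of ℤ M (p a) • S.fox p b := by
  induction a using FreeMonoid.recOn with
  | one => rw [one_mul, fox_one, zero_add, map_one, map_one, one_smul]
  | of_mul x w ih =>
    rw [mul_assoc, fox_of_mul, ih, fox_of_mul, smul_add, smul_smul, ← map_mul, ← map_mul, add_assoc]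

/-- The boundary `[x] ↦ x - 1`. -/
noncomputable def bdGen : (S.Gen →₀ MonoidAlgebra ℤ M) →ₗ[MonoidAlgebra ℤ M] MonoidAlgebra ℤ M :=
  Finsupp.linearCombination _ fun x => MonoidAlgebra.of ℤ M (p (FreeMonoid.of x)) - 1

theorem bdGen_fox (a : FreeMonoid S.Gen) :
    S.bdGen p (S.fox p a) = MonoidAlgebra.of ℤ M (p a) - 1 := by
  induction a using FreeMonoid.recOn with
  | one => rw [fox_one, map_zero, map_one, map_one, sub_self]
  | of_mul x w ih =>
    rw [fox_of_mul, map_add, map_smul, ih, smul_eq_mul, mul_sub, ← map_mul, ← map_mul, bdGen,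
      Finsupp.linearCombination_single, one_smul, mul_one]
    abel

/-- The boundary `[r] ↦ ∂ (src r) - ∂ (tgt r)`. -/
noncomputable def bdRule :
    (S.Rule →₀ MonoidAlgebra ℤ M) →ₗ[MonoidAlgebra ℤ M] (S.Gen →₀ MonoidAlgebra ℤ M) :=
  Finsupp.linearCombination _ fun r => S.fox p (S.src r) - S.fox p (S.tgt r)

/-! ### Classes of rewriting paths -/

/-- The class `l • [r]` of the rewriting step which applies `r` with left context `l`. -/
noncomputable def stepClass (l : FreeMonoid S.Gen) (r : S.Rule) : S.Rule →₀ MonoidAlgebra ℤ M :=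
  Finsupp.single r (MonoidAlgebra.of ℤ M (p l))

theorem smul_stepClass (a l : FreeMonoid S.Gen) (r : S.Rule) :
    MonoidAlgebra.of ℤ M (p a) • S.stepClass p l r = S.stepClass p (a * l) r := by
  rw [stepClass, stepClass, Finsupp.smul_single, smul_eq_mul, ← map_mul, ← map_mul]

/-- `PathClass u v z`: there is a rewriting path from `u` to `v` of class `z`. -/
inductive PathClass : FreeMonoid S.Gen → FreeMonoid S.Gen → (S.Rule →₀ MonoidAlgebra ℤ M) → Prop
  | refl (u) : PathClass u u 0
  | head (l r l' v z) : PathClass (l * S.tgt r * l') v z →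
      PathClass (l * S.src r * l') v (S.stepClass p l r + z)

variable {S p}

theorem PathClass.trans {u v t : FreeMonoid S.Gen} {y z} (h : S.PathClass p u v y)
    (h' : S.PathClass p v t z) : S.PathClass p u t (y + z) := by
  induction h with
  | refl => simpa using h'
  | head l r l' v y _ ih => rw [add_assoc]; exact .head _ _ _ _ _ (ih h')

theorem PathClass.step (l : FreeMonoid S.Gen) (r : S.Rule) (l' : FreeMonoid S.Gen) :
    S.PathClass p (l * S.src r * l') (l * S.tgt r * l') (S.stepClass p l r) := by
  simpa using PathClass.head l r l' _ 0 (.refl (p := p) _)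

theorem PathClass.context {u v : FreeMonoid S.Gen} {z} (h : S.PathClass p u v z)
    (a c : FreeMonoid S.Gen) :
    S.PathClass p (a * u * c) (a * v * c) (MonoidAlgebra.of ℤ M (p a) • z) := by
  induction h with
  | refl => simpa using .refl _
  | head l r l' v z _ ih =>
    rw [smul_add, smul_stepClass]
    have := PathClass.head (p := p) (a * l) r (l' * c) (a * v * c) _ (by simpa [mul_assoc] using ih)
    simpa [mul_assoc] using this

theorem PathClass.rewrites {u v : FreeMonoid S.Gen} {z} (h : S.PathClass p u v z) :
    S.Rewrites u v := by
  induction h with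
  | refl => exact .refl
  | head l r l' v z _ ih => exact .head ⟨l, r, l', rfl, rfl⟩ ih

theorem Rewrites.exists_pathClass {u v : FreeMonoid S.Gen} (h : S.Rewrites u v) :
    ∃ z, S.PathClass p u v z := by
  induction h using Relation.ReflTransGen.head_induction_on with
  | refl => exact ⟨0, .refl _⟩
  | head h _ ih =>
    obtain ⟨l, r, l', rfl, rfl⟩ := h
    obtain ⟨z, hz⟩ := ih
    exact ⟨_, .head _ _ _ _ _ hz⟩

theorem PathClass.cases {u v : FreeMonoid S.Gen} {z} (h : S.PathClass p u v z) :
    (u = v ∧ z = 0) ∨ ∃ l r l' y, u = l * S.src r * l' ∧ z = S.stepClass p l r + y ∧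
      S.PathClass p (l * S.tgt r * l') v y := by
  cases h with
  | refl => exact .inl ⟨rfl, rfl⟩
  | head l r l' v y h => exact .inr ⟨l, r, l', y, rfl, rfl, h⟩

theorem PathClass.map_eq (hp : ∀ r, p (S.src r) = p (S.tgt r)) {u v : FreeMonoid S.Gen} {z}
    (h : S.PathClass p u v z) : p u = p v := by
  induction h with
  | refl => rfl
  | head l r l' v z _ ih => rw [← ih]; simp [hp]

/-- The Fox derivative of the right context cancels because `p` identifies the two sides of a rule;
the sum along the path telescopes. -/
theorem PathClass.bdRule_eq (hp : ∀ r, p (S.src r) = p (S.tgt r)) {u v : FreeMonoid S.Gen} {z}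
    (h : S.PathClass p u v z) : S.bdRule p z = S.fox p u - S.fox p v := by
  induction h with
  | refl => simp
  | head l r l' v z _ ih =>
    rw [map_add, ih, stepClass, bdRule, Finsupp.linearCombination_single]
    simp only [fox_mul, map_mul, hp, smul_sub]
    abel

/-! ### Normal forms and local branchings -/

variable (S p)

/-- A choice of normal forms of words and of rewriting paths to them, compatible with `p`. -/
structure Normalization where
  nf : FreeMonoid S.Gen → FreeMonoid S.Gen
  pathTo : FreeMonoid S.Gen → (S.Rule →₀ MonoidAlgebra ℤ M)
  path : ∀ u, S.PathClass p u (nf u) (pathTo u)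
  irreducible : ∀ u v, ¬ S.Step (nf u) v
  nf_eq : ∀ u v, p u = p v → nf u = nf v

variable {S p}

namespace Normalization

variable (N : S.Normalization p)

/-- The classes of the loops formed by two steps out of a common word of length at most `n` and
the chosen normalizations of their targets. -/
def branchings (n : ℕ) : Set (S.Rule →₀ MonoidAlgebra ℤ M) :=
  {z | ∃ l₁ r₁ l₁' l₂ r₂ l₂', l₁ * S.src r₁ * l₁' = l₂ * S.src r₂ * l₂' ∧
    (l₁ * S.src r₁ * l₁').length ≤ n ∧
    z = (S.stepClass p l₁ r₁ + N.pathTo (l₁ * S.tgt r₁ * l₁')) -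
      (S.stepClass p l₂ r₂ + N.pathTo (l₂ * S.tgt r₂ * l₂'))}

theorem finite_branchings (hS : S.IsFinite) (n : ℕ) : (N.branchings n).Finite := by
  have := hS.1
  have := hS.2
  let T : Set (FreeMonoid S.Gen) := {w | w.length ≤ n}
  have hT : T.Finite := List.finite_length_le S.Gen n
  have := hT.to_subtype
  let f : (T × S.Rule × T) × (T × S.Rule × T) → (S.Rule →₀ MonoidAlgebra ℤ M) := fun q =>
    (S.stepClass p q.1.1 q.1.2.1 + N.pathTo (q.1.1 * S.tgt q.1.2.1 * q.1.2.2)) -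
      (S.stepClass p q.2.1 q.2.2.1 + N.pathTo (q.2.1 * S.tgt q.2.2.1 * q.2.2.2))
  refine (Set.finite_range f).subset ?_
  rintro z ⟨l₁, r₁, l₁', l₂, r₂, l₂', h, hn, rfl⟩
  have hn' := h ▸ hn
  simp only [FreeMonoid.length_mul] at hn hn'
  exact ⟨((⟨l₁, show FreeMonoid.length l₁ ≤ n by omega⟩, r₁, ⟨l₁', show FreeMonoid.length l₁' ≤ n by omega⟩),
    (⟨l₂, show FreeMonoid.length l₂ ≤ n by omega⟩, r₂, ⟨l₂', show FreeMonoid.length l₂' ≤ n by omega⟩)), rfl⟩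

theorem bdRule_branchings (hp : ∀ r, p (S.src r) = p (S.tgt r)) (n : ℕ) :
    ∀ z ∈ N.branchings n, S.bdRule p z = 0 := by
  rintro z ⟨l₁, r₁, l₁', l₂, r₂, l₂', h, -, rfl⟩
  have h₁ := PathClass.head (p := p) l₁ r₁ l₁' _ _ (N.path _)
  have h₂ := PathClass.head (p := p) l₂ r₂ l₂' _ _ (N.path _)
  have e : N.nf (l₁ * S.tgt r₁ * l₁') = N.nf (l₂ * S.tgt r₂ * l₂') := by
    apply N.nf_eq
    have := congrArg p h
    simpa [hp] using this
  rw [map_sub, h₁.bdRule_eq hp, h₂.bdRule_eq hp, h, e, sub_self]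

theorem nf_eq_of_path (hp : ∀ r, p (S.src r) = p (S.tgt r)) {u v : FreeMonoid S.Gen} {z}
    (h : S.PathClass p u v z) : N.nf u = N.nf v := N.nf_eq _ _ (h.map_eq hp)

theorem pathTo_of_irreducible {u : FreeMonoid S.Gen} (h : ∀ v, ¬ S.Step u v) :
    N.pathTo u = 0 ∧ N.nf u = u := by
  obtain ⟨e, h'⟩ | ⟨l, r, l', y, rfl, -, -⟩ := (N.path u).cases
  · exact ⟨h', e.symm⟩
  · exact absurd ⟨l, r, l', rfl, rfl⟩ (h _)

/-- Two steps out of `u` can be completed to a common word by paths whose classes differ by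
an element of the module spanned by the branchings. -/
theorem exists_confluence (hp : ∀ r, p (S.src r) = p (S.tgt r)) {n : ℕ}
    (hn : ∀ r₁ r₂, (S.src r₁).length + (S.src r₂).length ≤ n)
    (l₁ : FreeMonoid S.Gen) (r₁ : S.Rule) (l₁' l₂ : FreeMonoid S.Gen) (r₂ : S.Rule)
    (l₂' : FreeMonoid S.Gen) (h : l₁ * S.src r₁ * l₁' = l₂ * S.src r₂ * l₂') :
    ∃ t z₁ z₂, S.PathClass p (l₁ * S.tgt r₁ * l₁') t z₁ ∧ S.PathClass p (l₂ * S.tgt r₂ * l₂') t z₂ ∧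
      (S.stepClass p l₁ r₁ + z₁) - (S.stepClass p l₂ r₂ + z₂) ∈
        Submodule.span (MonoidAlgebra ℤ M) (N.branchings n) := by
  -- By symmetry the first step starts no further right than the second.
  wlog H : ∃ e, l₂ = l₁ * e generalizing l₁ r₁ l₁' l₂ r₂ l₂'
  · have H' : ∃ e, l₁ = l₂ * e := by
      rw [mul_assoc, mul_assoc, freeMonoid_mul_eq_mul_iff] at h
      obtain ⟨e, he, -⟩ | ⟨e, he, -⟩ := h
      · exact absurd ⟨e, he⟩ H
      · exact ⟨e, he⟩
    obtain ⟨t, z₁, z₂, h₁, h₂, hz⟩ := this _ _ _ _ _ _ h.symm H'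
    exact ⟨t, z₂, z₁, h₂, h₁, by rw [← neg_sub]; exact neg_mem hz⟩
  obtain ⟨e, rfl⟩ := H
  -- a branching out of a word of length at most `n`, put in context
  have overlap (b b' c : FreeMonoid S.Gen) (hw : S.src r₁ * b = e * S.src r₂ * b')
      (hl : (S.src r₁ * b).length ≤ n) (h₁ : l₁' = b * c) (h₂ : l₂' = b' * c) :
      ∃ t z₁ z₂, S.PathClass p (l₁ * S.tgt r₁ * l₁') t z₁ ∧
        S.PathClass p (l₁ * e * S.tgt r₂ * l₂') t z₂ ∧
        (S.stepClass p l₁ r₁ + z₁) - (S.stepClass p (l₁ * e) r₂ + z₂) ∈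
          Submodule.span (MonoidAlgebra ℤ M) (N.branchings n) := by
    subst h₁ h₂
    have e' : N.nf (S.tgt r₁ * b) = N.nf (e * S.tgt r₂ * b') := by
      apply N.nf_eq
      have := congrArg p hw
      simpa [hp] using this
    refine ⟨l₁ * N.nf (S.tgt r₁ * b) * c,
      MonoidAlgebra.of ℤ M (p l₁) • N.pathTo (S.tgt r₁ * b),
      MonoidAlgebra.of ℤ M (p l₁) • N.pathTo (e * S.tgt r₂ * b'), ?_, ?_, ?_⟩
    · simpa [mul_assoc] using (N.path (S.tgt r₁ * b)).context l₁ c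
    · rw [e']
      simpa [mul_assoc] using (N.path (e * S.tgt r₂ * b')).context l₁ c
    · have := Submodule.smul_mem _ (MonoidAlgebra.of ℤ M (p l₁))
        (Submodule.subset_span (s := N.branchings n) ⟨1, r₁, b, e, r₂, b', by simpa using hw,
          by simpa using hl, rfl⟩)
      rw [smul_sub, smul_add, smul_add, smul_stepClass, smul_stepClass, mul_one, one_mul] at this
      exact this
  have h' : S.src r₁ * l₁' = e * (S.src r₂ * l₂') := by
    simpa [mul_assoc] using h
  rw [freeMonoid_mul_eq_mul_iff] at h'
  obtain ⟨b, rfl, rfl⟩ | ⟨b, hb, hb'⟩ := h'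
  -- Disjoint sources: the two steps commute, and the square has class zero since replacing `src r₁`
  -- by `tgt r₁` in a left context does not change its image in `M`.
  · refine ⟨l₁ * S.tgt r₁ * b * S.tgt r₂ * l₂', S.stepClass p (l₁ * S.tgt r₁ * b) r₂,
      S.stepClass p l₁ r₁, ?_, ?_, ?_⟩
    · simpa [mul_assoc] using PathClass.step (p := p) (l₁ * S.tgt r₁ * b) r₂ l₂'
    · simpa [mul_assoc] using PathClass.step (p := p) l₁ r₁ (b * S.tgt r₂ * l₂')
    · have : S.stepClass p (l₁ * (S.src r₁ * b)) r₂ = S.stepClass p (l₁ * S.tgt r₁ * b) r₂ := by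
        simp only [stepClass, map_mul, hp, mul_assoc]
      rw [this, add_comm, sub_self]
      exact zero_mem _
  · rw [freeMonoid_mul_eq_mul_iff] at hb'
    obtain ⟨c, rfl, rfl⟩ | ⟨c, hc, rfl⟩ := hb'
    -- Here `src r₂` lies inside `src r₁`; in the other case it ends at or beyond the end of `src
    -- r₁`.
    · exact overlap 1 c l₁' (by rw [hb]; simp [mul_assoc])
        (by have := hn r₁ r₂; simp; omega) (by simp) rfl
    · refine overlap c 1 l₂' (by rw [hb, hc]; simp [mul_assoc]) ?_ rfl (by simp)
      have := hn r₁ r₂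
      rw [hc] at this
      simp only [FreeMonoid.length_mul] at this ⊢
      omega

/-- Modulo the branchings, all paths from `u` to its normal form have the same class. -/
theorem sub_pathTo_mem (hp : ∀ r, p (S.src r) = p (S.tgt r)) (wf : WellFounded (flip S.Step))
    {n : ℕ} (hn : ∀ r₁ r₂, (S.src r₁).length + (S.src r₂).length ≤ n)
    (u : FreeMonoid S.Gen) : ∀ z, S.PathClass p u (N.nf u) z →
      z - N.pathTo u ∈ Submodule.span (MonoidAlgebra ℤ M) (N.branchings n) := by
  induction u using wf.induction with
  | _ u ih =>
  intro z hz
  obtain ⟨e, rfl⟩ | ⟨l₁, r₁, l₁', z₁, rfl, rfl, hz₁⟩ := hz.cases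
  · rw [(N.pathTo_of_irreducible (e ▸ N.irreducible u)).1, sub_zero]
    exact zero_mem _
  obtain ⟨e, -⟩ | ⟨l₂, r₂, l₂', z₂, h, hN, hz₂⟩ := (N.path (l₁ * S.src r₁ * l₁')).cases
  · exact absurd ⟨l₁, r₁, l₁', e.symm, rfl⟩ (N.irreducible _ (l₁ * S.tgt r₁ * l₁'))
  -- Newman's argument: close the two first steps at `t`, then use induction at both targets to
  -- compare each given path with the one through `t`.
  obtain ⟨t, y₁, y₂, hy₁, hy₂, hy⟩ := N.exists_confluence hp hn _ _ _ _ _ _ h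
  rw [hN]
  rw [N.nf_eq_of_path hp (.step l₁ r₁ l₁')] at hz₁
  rw [h, N.nf_eq_of_path hp (.step l₂ r₂ l₂')] at hz₂
  have i₁ := ih _ ⟨l₁, r₁, l₁', rfl, rfl⟩
  have i₂ := ih _ ⟨l₂, r₂, l₂', h, rfl⟩
  have a₁ := i₁ _ hz₁
  have a₂ := i₂ _ hz₂
  have b₁ := i₁ _ (by rw [N.nf_eq_of_path hp hy₁]; exact hy₁.trans (N.path t))
  have b₂ := i₂ _ (by rw [N.nf_eq_of_path hp hy₂]; exact hy₂.trans (N.path t))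
  convert add_mem (sub_mem (sub_mem a₁ a₂) (sub_mem b₁ b₂)) hy using 1
  abel

theorem pathTo_sub_mem_of_path (hp : ∀ r, p (S.src r) = p (S.tgt r))
    (wf : WellFounded (flip S.Step))
    {n : ℕ} (hn : ∀ r₁ r₂, (S.src r₁).length + (S.src r₂).length ≤ n)
    {u v : FreeMonoid S.Gen} {z} (h : S.PathClass p u v z) :
    z + N.pathTo v - N.pathTo u ∈ Submodule.span (MonoidAlgebra ℤ M) (N.branchings n) :=
  N.sub_pathTo_mem hp wf hn u _ (by rw [N.nf_eq_of_path hp h]; exact h.trans (N.path v))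

/-! ### Contracting homotopy and the kernel of `bdRule` -/

/-- The contracting homotopy in degree one, `m • [x] ↦ pathTo (m̂ x)` for a section `m ↦ m̂`. -/
noncomputable def homotopyGen (s : M → FreeMonoid S.Gen) :
    (S.Gen →₀ MonoidAlgebra ℤ M) →+ (S.Rule →₀ MonoidAlgebra ℤ M) :=
  extendAdd fun x m => N.pathTo (N.nf (s m) * FreeMonoid.of x)

theorem map_nf (hp : ∀ r, p (S.src r) = p (S.tgt r)) (u : FreeMonoid S.Gen) : p (N.nf u) = p u :=
  ((N.path u).map_eq hp).symm

theorem bdRule_homotopyGen (hp : ∀ r, p (S.src r) = p (S.tgt r)) {s : M → FreeMonoid S.Gen}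
    (hs : ∀ m, p (s m) = m) (y : S.Gen →₀ MonoidAlgebra ℤ M) (hy : S.bdGen p y = 0) :
    S.bdRule p (N.homotopyGen s y) = y := by
  -- The homotopy one degree lower: its sum with the next one satisfies `∂h + s₀∂ = id`.
  let s₀ : MonoidAlgebra ℤ M →+ (S.Gen →₀ MonoidAlgebra ℤ M) :=
    (extendAdd fun (_ : Unit) m => S.fox p (N.nf (s m))).comp (Finsupp.singleAddHom ())
  have hs₀ (m : M) : s₀ (MonoidAlgebra.of ℤ M m) = S.fox p (N.nf (s m)) :=
    extendAdd_single _ _ _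
  have key : (S.bdRule p).toAddMonoidHom.comp (N.homotopyGen s) +
      s₀.comp (S.bdGen p).toAddMonoidHom = AddMonoidHom.id _ := by
    refine addHom_ext_of fun x m => ?_
    have e₁ : N.homotopyGen s (Finsupp.single x (MonoidAlgebra.of ℤ M m)) =
      N.pathTo (N.nf (s m) * FreeMonoid.of x) := extendAdd_single _ _ _
    have e₂ : S.bdGen p (Finsupp.single x (MonoidAlgebra.of ℤ M m)) =
        MonoidAlgebra.of ℤ M (m * p (FreeMonoid.of x)) - MonoidAlgebra.of ℤ M m := by
      rw [bdGen, Finsupp.linearCombination_single, smul_eq_mul, mul_sub, mul_one, ← map_mul]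
    have e₃ : N.nf (N.nf (s m) * FreeMonoid.of x) = N.nf (s (m * p (FreeMonoid.of x))) :=
      N.nf_eq _ _ (by simp [map_nf N hp, hs])
    change S.bdRule p (N.homotopyGen s _) + s₀ (S.bdGen p _) = _
    rw [e₁, e₂, (N.path _).bdRule_eq hp, map_sub, hs₀, hs₀, e₃, fox_mul, fox_of,
      N.map_nf hp, hs, Finsupp.smul_single, smul_eq_mul, mul_one, AddMonoidHom.id_apply]
    abel
  have := DFunLike.congr_fun key y
  change S.bdRule p (N.homotopyGen s y) + s₀ (S.bdGen p y) = y at this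
  rwa [hy, map_zero, add_zero] at this

/-- Normalizing `m̂ w` letter by letter from the left is one path to its normal form, so modulo
branchings it has the class of the chosen one. -/
theorem homotopyGen_smul_fox (hp : ∀ r, p (S.src r) = p (S.tgt r))
    (wf : WellFounded (flip S.Step))
    {n : ℕ} (hn : ∀ r₁ r₂, (S.src r₁).length + (S.src r₂).length ≤ n)
    {s : M → FreeMonoid S.Gen} (hs : ∀ m, p (s m) = m) (w : FreeMonoid S.Gen) : ∀ (m : M),
    N.homotopyGen s (MonoidAlgebra.of ℤ M m • S.fox p w) - N.pathTo (N.nf (s m) * w) ∈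
      Submodule.span (MonoidAlgebra ℤ M) (N.branchings n) := by
  induction w using FreeMonoid.recOn with
  | one =>
    intro m
    simp [N.pathTo_of_irreducible (N.irreducible _)]
  | of_mul x w ih =>
    intro m
    have e₁ : N.homotopyGen s (Finsupp.single x (MonoidAlgebra.of ℤ M m)) =
      N.pathTo (N.nf (s m) * FreeMonoid.of x) := extendAdd_single _ _ _
    have e₃ : N.nf (N.nf (s m) * FreeMonoid.of x) = N.nf (s (m * p (FreeMonoid.of x))) :=
      N.nf_eq _ _ (by simp [map_nf N hp, hs])
    have h := (N.path (N.nf (s m) * FreeMonoid.of x)).context 1 w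
    rw [e₃] at h
    have := N.pathTo_sub_mem_of_path hp wf hn h
    rw [fox_of_mul, smul_add, map_add, Finsupp.smul_single, smul_eq_mul, mul_one, e₁, smul_smul,
      ← map_mul]
    convert add_mem (ih (m * p (FreeMonoid.of x))) this using 1
    simp only [map_one, one_smul, one_mul, mul_assoc]
    abel

theorem ker_bdRule (hp : ∀ r, p (S.src r) = p (S.tgt r)) (wf : WellFounded (flip S.Step))
    {n : ℕ} (hn : ∀ r₁ r₂, (S.src r₁).length + (S.src r₂).length ≤ n)
    (hsurj : Function.Surjective p) :
    LinearMap.ker (S.bdRule p) = Submodule.span (MonoidAlgebra ℤ M) (N.branchings n) := by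
  apply le_antisymm
  · intro z hz
    obtain ⟨s, hs⟩ := hsurj.hasRightInverse
    set K := Submodule.span (MonoidAlgebra ℤ M) (N.branchings n)
    -- The homotopy is only additive, so `h ∂ ≡ id` modulo `K` is checked on the `ℤ`-basis `m •
    -- [r]`, the class of the step `m̂ (src r) ⇒ m̂ (tgt r)`.
    have key : (QuotientAddGroup.mk' K.toAddSubgroup) =
        (QuotientAddGroup.mk' K.toAddSubgroup).comp
          ((N.homotopyGen s).comp (S.bdRule p).toAddMonoidHom) := by
      refine addHom_ext_of fun r m => ?_
      change QuotientAddGroup.mk' _ _ =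
        QuotientAddGroup.mk' _ (N.homotopyGen s (S.bdRule p _))
      refine ((QuotientAddGroup.eq_iff_sub_mem).2 ?_)
      change _ ∈ K
      rw [bdRule, Finsupp.linearCombination_single, smul_sub, map_sub]
      have h₁ := N.homotopyGen_smul_fox hp wf hn hs (S.src r) m
      have h₂ := N.homotopyGen_smul_fox hp wf hn hs (S.tgt r) m
      have h₃ := N.pathTo_sub_mem_of_path hp wf hn (.step (N.nf (s m)) r 1)
      rw [stepClass, N.map_nf hp, hs, mul_one, mul_one] at h₃
      convert add_mem (sub_mem h₂ h₁) h₃ using 1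
      abel
    have := DFunLike.congr_fun key z
    change QuotientAddGroup.mk' _ _ =
        QuotientAddGroup.mk' _ (N.homotopyGen s (S.bdRule p _)) at this
    rw [LinearMap.mem_ker.1 hz, map_zero, map_zero] at this
    exact (QuotientAddGroup.eq_zero_iff z).1 this
  · exact Submodule.span_le.2 (N.bdRule_branchings hp n)

end Normalization

theorem bdGen_bdRule (hp : ∀ r, p (S.src r) = p (S.tgt r)) (z : S.Rule →₀ MonoidAlgebra ℤ M) :
    S.bdGen p (S.bdRule p z) = 0 := by
  have : S.bdGen p ∘ₗ S.bdRule p = 0 := by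
    ext r : 2
    simp [bdRule, bdGen_fox, hp]
  exact LinearMap.congr_fun this z

/-! ### Normal forms from convergence -/

/-- A convergent system has normal forms for every morphism which it presents. -/
theorem Convergent.nonempty_normalization (hS : S.Convergent)
    (hp : ∀ a b, p a = p b → conGen S.Rel a b) (wf : WellFounded (flip S.Step)) :
    Nonempty (S.Normalization p) := by
  have rewrites_mul {a b c d : FreeMonoid S.Gen} (h : S.Rewrites a b) (h' : S.Rewrites c d) :
      S.Rewrites (a * c) (b * d) := by
    -- Classes over the trivial monoid carry no needed information; they only give closure of
    -- rewriting under contexts.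
    obtain ⟨y, hy⟩ := h.exists_pathClass (p := (1 : FreeMonoid S.Gen →* Unit))
    obtain ⟨z, hz⟩ := h'.exists_pathClass (p := (1 : FreeMonoid S.Gen →* Unit))
    have h₁ := (hy.context 1 c).rewrites
    have h₂ := (hz.context b 1).rewrites
    rw [one_mul, one_mul] at h₁
    rw [mul_one, mul_one] at h₂
    exact h₁.trans h₂
  -- Joinability is a congruence, its transitivity being confluence; it contains the rules, so words
  -- with equal image are joinable.
  let J : Con (FreeMonoid S.Gen) :=
    { r := fun a b => ∃ e, S.Rewrites a e ∧ S.Rewrites b e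
      iseqv := by
        refine ⟨fun a => ⟨a, .refl, .refl⟩, fun ⟨e, h, h'⟩ => ⟨e, h', h⟩, ?_⟩
        rintro a b c ⟨e, h₁, h₂⟩ ⟨e', h₃, h₄⟩
        obtain ⟨t, h₅, h₆⟩ := hS.2 _ _ _ h₂ h₃
        exact ⟨t, h₁.trans h₅, h₄.trans h₆⟩
      mul' := by
        rintro a b c d ⟨e, h₁, h₂⟩ ⟨e', h₃, h₄⟩
        exact ⟨e * e', rewrites_mul h₁ h₃, rewrites_mul h₂ h₄⟩ }
  have hJ : conGen S.Rel ≤ J := by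
    refine Con.conGen_le.2 ?_
    rintro a b ⟨r, rfl, rfl⟩
    exact ⟨S.tgt r, .single ⟨1, r, 1, by simp, by simp⟩, .refl⟩
  have hnf (u : FreeMonoid S.Gen) : ∃ v, S.Rewrites u v ∧ ∀ t, ¬ S.Step v t := by
    induction u using wf.induction with
    | _ u ih =>
    by_cases h : ∃ t, S.Step u t
    · obtain ⟨t, ht⟩ := h
      obtain ⟨v, hv, hv'⟩ := ih t ht
      exact ⟨v, hv.head ht, hv'⟩
    · exact ⟨u, .refl, fun t ht => h ⟨t, ht⟩⟩
  have eq_of {a b : FreeMonoid S.Gen} (h : S.Rewrites a b) (ha : ∀ t, ¬ S.Step a t) : a = b := by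
    obtain h | ⟨t, ht, -⟩ := h.cases_head
    · exact h
    · exact absurd ht (ha t)
  choose nf h₁ h₂ using hnf
  choose P hP using fun u => (h₁ u).exists_pathClass (p := p)
  refine ⟨⟨nf, P, hP, h₂, fun a b hab => ?_⟩⟩
  obtain ⟨e, ha, hb⟩ := hJ (hp a b hab)
  obtain ⟨t, h₃, h₄⟩ := hS.2 _ _ _ (h₁ a) ha
  obtain ⟨t', h₅, h₆⟩ := hS.2 _ _ _ (hb.trans h₄) (h₁ b)
  rw [eq_of h₃ (h₂ a), eq_of h₆ (h₂ b)]
  exact eq_of h₅ (by rw [← eq_of h₃ (h₂ a)]; exact h₂ a)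

theorem Terminates.wellFounded (h : S.Terminates) : WellFounded (flip S.Step) := by
  rw [wellFounded_iff_isEmpty_descending_chain]
  exact ⟨fun f => h ⟨f.1, f.2⟩⟩

end StringRewritingSystem

/-! ### Augmentation and assembly of the resolution -/

/-- The augmentation `ℤM → ℤ`. -/
noncomputable def augmentation (M : Type u) [Monoid M] :
    MonoidAlgebra ℤ M →ₗ[MonoidAlgebra ℤ M] TrivialModule M :=
  LinearMap.toSpanSingleton _ _ ((Representation.trivial ℤ M ℤ).asModuleEquiv.symm 1)

theorem augmentation_of (M : Type u) [Monoid M] (m : M) : augmentation M (MonoidAlgebra.of ℤ M m) =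
    (Representation.trivial ℤ M ℤ).asModuleEquiv.symm 1 := by
  rw [augmentation, LinearMap.toSpanSingleton_apply, ← Representation.asModuleEquiv_symm_map_rho]
  rfl

theorem surjective_augmentation (M : Type u) [Monoid M] :
    Function.Surjective (augmentation M) := by
  intro k
  refine ⟨(Representation.trivial ℤ M ℤ).asModuleEquiv k • (MonoidAlgebra.of ℤ M 1), ?_⟩
  rw [map_zsmul, augmentation_of, ← map_zsmul, zsmul_eq_mul, mul_one]
  exact LinearEquiv.symm_apply_apply _ _

/-- An element of `ℤM` in the kernel of the augmentation is killed by every additive map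
which kills all `m - 1`. -/
theorem map_eq_zero_of_augmentation {M : Type u} [Monoid M] {B : Type*} [AddCommGroup B]
    (f : MonoidAlgebra ℤ M →+ B) (hf : ∀ m, f (MonoidAlgebra.of ℤ M m) = f 1)
    (a : MonoidAlgebra ℤ M) (ha : augmentation M a = 0) : f a = 0 := by
  have key : f = ((zmultiplesHom B (f 1)).comp
      (Representation.trivial ℤ M ℤ).asModuleEquiv.toLinearMap.toAddMonoidHom).comp
        (augmentation M).toAddMonoidHom := by
    refine MonoidAlgebra.addHom_ext' fun m => ?_
    ext
    change f (MonoidAlgebra.of ℤ M m) = zmultiplesHom B (f 1)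
      ((Representation.trivial ℤ M ℤ).asModuleEquiv (augmentation M (MonoidAlgebra.of ℤ M m)))
    rw [augmentation_of, LinearEquiv.apply_symm_apply, hf]
    simp
  rw [key]
  change zmultiplesHom B (f 1)
      ((Representation.trivial ℤ M ℤ).asModuleEquiv (augmentation M a)) = 0
  rw [ha, map_zero, map_zero]

theorem StringRewritingSystem.exact_bdGen_augmentation (S : StringRewritingSystem.{v, w})
    {M : Type u} [Monoid M] (p : FreeMonoid S.Gen →* M) (hsurj : Function.Surjective p) :
    Function.Exact (S.bdGen p) (augmentation M) := by
  rw [LinearMap.exact_iff]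
  apply le_antisymm
  · intro a ha
    have := map_eq_zero_of_augmentation
      -- Modulo the range every `m` equals `1`, as `m - 1` is the boundary of the Fox derivative of
      -- any lift.
      (QuotientAddGroup.mk' (LinearMap.range (S.bdGen p)).toAddSubgroup) (fun m => ?_) a ha
    · exact (QuotientAddGroup.eq_zero_iff a).1 this
    · obtain ⟨u, rfl⟩ := hsurj m
      exact QuotientAddGroup.eq_iff_sub_mem.2 ⟨S.fox p u, S.bdGen_fox p u⟩
  · rintro _ ⟨y, rfl⟩
    have : augmentation M ∘ₗ S.bdGen p = 0 := by
      refine Finsupp.lhom_ext' fun x => LinearMap.ext_ring ?_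
      change augmentation M (S.bdGen p (Finsupp.single x 1)) = 0
      rw [← S.fox_of p x, S.bdGen_fox, map_sub, augmentation_of, ← map_one (MonoidAlgebra.of ℤ M),
        augmentation_of, sub_self]
    exact LinearMap.congr_fun this y

/-- Assemble a partial resolution of length three out of finitely generated free modules. -/
theorem IsOfHomologicalTypeLeftFP.of_exact {M : Type u} [Monoid M] {X : Type*} {Y : Type*}
    [Finite X] [Finite Y]
    (d₀ : (X →₀ MonoidAlgebra ℤ M) →ₗ[MonoidAlgebra ℤ M] MonoidAlgebra ℤ M)
    (d₁ : (Y →₀ MonoidAlgebra ℤ M) →ₗ[MonoidAlgebra ℤ M] (X →₀ MonoidAlgebra ℤ M))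
    (h₀ : Function.Exact d₀ (augmentation M)) (h₁ : Function.Exact d₁ d₀)
    (h₂ : (LinearMap.ker d₁).FG) : IsOfHomologicalTypeLeftFP 3 M := by
  -- Reindexing by `Fin` puts the free modules in the universe of `M`, whatever those of `X` and
  -- `Y`.
  obtain ⟨n, ⟨eX⟩⟩ := Finite.exists_equiv_fin X
  obtain ⟨m, ⟨eY⟩⟩ := Finite.exists_equiv_fin Y
  have := Module.Finite.iff_fg.2 h₂
  obtain ⟨k, g, hg⟩ := Module.Finite.exists_fin' (MonoidAlgebra ℤ M) (LinearMap.ker d₁)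
  let A := MonoidAlgebra ℤ M
  let bX : (X →₀ A) ≃ₗ[A] (Fin n →₀ A) := Finsupp.domLCongr eX
  let bY : (Y →₀ A) ≃ₗ[A] (Fin m →₀ A) := Finsupp.domLCongr eY
  let b : (Fin 1 →₀ A) ≃ₗ[A] A := Finsupp.uniqueLinearEquiv A A (0 : Fin 1)
  let c : (Fin k →₀ A) ≃ₗ[A] (Fin k → A) := Finsupp.linearEquivFunOnFinite A A (Fin k)
  have h₂' : Function.Exact ((LinearMap.ker d₁).subtype ∘ₗ g) d₁ := by
    rw [LinearMap.exact_iff, LinearMap.range_comp, LinearMap.range_eq_top.2 hg,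
      Submodule.map_top, Submodule.range_subtype]
  let r : ℕ → ℕ
    | 0 => 1
    | 1 => n
    | 2 => m
    | 3 => k
    | _ => 0
  let F : PartialResolution.{u, 0, u} (IntegralMonoidRing M) (TrivialModule M) 3 :=
    { P := fun i => Fin (r i) →₀ A
      ε := augmentation M ∘ₗ b.toLinearMap
      d := fun
        | 0 => b.symm.toLinearMap ∘ₗ d₀ ∘ₗ bX.symm.toLinearMap
        | 1 => bX.toLinearMap ∘ₗ d₁ ∘ₗ bY.symm.toLinearMap
        | 2 => bY.toLinearMap ∘ₗ ((LinearMap.ker d₁).subtype ∘ₗ g) ∘ₗ c.toLinearMap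
        | _ + 3 => 0
      surjective_ε := (surjective_augmentation M).comp b.surjective
      exact_zero := fun _ => by
        refine h₀.of_ladder_linearEquiv_of_exact (e₁ := bX) (e₂ := b.symm)
          (e₃ := LinearEquiv.refl _ _) ?_ ?_ <;> ext <;> simp
      exact_succ := fun i hi => by
        obtain rfl | rfl : i = 0 ∨ i = 1 := by omega
        · refine h₁.of_ladder_linearEquiv_of_exact (e₁ := bY) (e₂ := bX) (e₃ := b.symm) ?_ ?_ <;>
            refine LinearMap.ext fun y => ?_ <;> simp
        · refine h₂'.of_ladder_linearEquiv_of_exact (e₁ := c.symm) (e₂ := bY) (e₃ := bX) ?_ ?_ <;>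
            refine LinearMap.ext fun y => ?_ <;> simp }
  exact ⟨F, fun i _ => ⟨inferInstanceAs (Module.Finite A (Fin (r i) →₀ A)),
    inferInstanceAs (Module.Projective A (Fin (r i) →₀ A))⟩⟩

theorem theorem5p3p5 (M : Type u) [Monoid M]
    (hM : AdmitsFiniteConvergentPresentation.{u, v, w} M) :
    IsOfHomologicalTypeLeftFP 3 M := by
  obtain ⟨S, hfin, hconv, ⟨e⟩⟩ := hM
  let p : FreeMonoid S.Gen →* M := e.toMonoidHom.comp (PresentedMonoid.mk S.Rel)
  have hsurj : Function.Surjective p := e.surjective.comp PresentedMonoid.surjective_mk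
  have hp (r : S.Rule) : p (S.src r) = p (S.tgt r) :=
    congrArg e (PresentedMonoid.mk_eq_mk_of_rel ⟨r, rfl, rfl⟩)
  have hp' (a b : FreeMonoid S.Gen) (h : p a = p b) : conGen S.Rel a b :=
    PresentedMonoid.mk_eq_mk_iff.1 (e.injective h)
  have wf := hconv.1.wellFounded
  obtain ⟨N⟩ := hconv.nonempty_normalization hp' wf
  have := hfin.1
  have := hfin.2
  obtain ⟨n, hn⟩ : ∃ n, ∀ r₁ r₂, (S.src r₁).length + (S.src r₂).length ≤ n := by
    obtain ⟨n, hn⟩ := (Set.finite_range fun q : S.Rule × S.Rule =>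
      (S.src q.1).length + (S.src q.2).length).bddAbove
    exact ⟨n, fun r₁ r₂ => hn ⟨(r₁, r₂), rfl⟩⟩
  obtain ⟨s, hs⟩ := hsurj.hasRightInverse
  refine .of_exact (S.bdGen p) (S.bdRule p) (S.exact_bdGen_augmentation p hsurj)
    (fun y => ⟨fun hy => ⟨_, N.bdRule_homotopyGen hp hs y hy⟩, ?_⟩) ?_
  · rintro ⟨z, rfl⟩
    exact StringRewritingSystem.bdGen_bdRule hp z
  · rw [N.ker_bdRule hp wf hn hsurj]
    exact Submodule.fg_span (N.finite_branchings hfin n)
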